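/- Let $G$ be an abelian group. A subset of $G$ is elementary algebraic if it has the form $\{x\in G: nx=a\}$ with $n\in\mathbb{Z}$ and $a\in G$, and algebraic if it is an intersection of finite unions (the empty union included) of elementary algebraic sets. The algebraic sets are the closed sets of a topology $\mathfrak{Z}_G$ on $G$, the Zariski topology. A precompact metric group topology on $G$ is a metrizable group topology $\mathcal{T}$ such that $(G,\mathcal{T})$ is isomorphic, as a topological group, to a subgroup of some compact Hausdorff topological group. Let $\mathfrak{c}$ denote the cardinality of the continuum. Then the following conditions are equivalent: (i) $|G|\le\mathfrak{c}$; (ii) for every subset $X$ of $G$ there exists a precompact metric group topology $\mathcal{T}_X$ on $G$ such that the $\mathcal{T}_X$-closure of $X$ coincides with the $\mathfrak{Z}_G$-closure of $X$; (iii) for every countable family $\mathscr{X}$ of subsets of $G$ there exists a precompact metric group topology $\mathcal{T}_{\mathscr{X}}$ on $G$ such that, for every $X\in\mathscr{X}$, the $\mathcal{T}_{\mathscr{X}}$-closure of $X$ coincides with the $\mathfrak{Z}_G$-closure of $X$. -/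

import Mathlib

open scoped Topology Cardinal

namespace MarkovZariski

/-- A subset of an abelian group `G` is elementary algebraic if it is the solution set
`{x | n x = a}` of a single one-variable equation, with `n` an integer and `a` in `G`. -/
def IsElementaryAlgebraic {G : Type*} [AddCommGroup G] (E : Set G) : Prop :=
  ∃ (n : ℤ) (a : G), E = {x : G | n • x = a}

/-- A finite (possibly empty) union of elementary algebraic sets. -/
def IsFiniteUnionOfElementary {G : Type*} [AddCommGroup G] (F : Set G) : Prop :=
  ∃ S : Set (Set G), S.Finite ∧ (∀ E ∈ S, IsElementaryAlgebraic E) ∧ F = ⋃₀ S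

/-- A subset of `G` is algebraic if it is an intersection of finite unions of elementary
algebraic sets (the empty intersection being `G`). -/
def IsAlgebraic {G : Type*} [AddCommGroup G] (A : Set G) : Prop :=
  ∃ 𝓕 : Set (Set G), (∀ F ∈ 𝓕, IsFiniteUnionOfElementary F) ∧ A = ⋂₀ 𝓕

theorem IsFiniteUnionOfElementary.union {G : Type*} [AddCommGroup G] {F F' : Set G}
    (h : IsFiniteUnionOfElementary F) (h' : IsFiniteUnionOfElementary F') :
    IsFiniteUnionOfElementary (F ∪ F') := by
  obtain ⟨S, hS, hE, rfl⟩ := h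
  obtain ⟨S', hS', hE', rfl⟩ := h'
  refine ⟨S ∪ S', hS.union hS', ?_, (Set.sUnion_union S S').symm⟩
  rintro E (h | h)
  · exact hE E h
  · exact hE' E h

theorem isAlgebraic_empty {G : Type*} [AddCommGroup G] : IsAlgebraic (∅ : Set G) :=
  ⟨{∅}, by
    rintro F rfl
    exact ⟨∅, Set.finite_empty, by simp, by simp⟩, by simp⟩

theorem isAlgebraic_sInter {G : Type*} [AddCommGroup G] (𝓐 : Set (Set G))
    (h : ∀ A ∈ 𝓐, IsAlgebraic A) : IsAlgebraic (⋂₀ 𝓐) := by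
  refine ⟨{F | IsFiniteUnionOfElementary F ∧ ⋂₀ 𝓐 ⊆ F}, fun F hF => hF.1, ?_⟩
  apply Set.Subset.antisymm
  · exact Set.subset_sInter fun F hF => hF.2
  · refine Set.subset_sInter fun A hA => ?_
    obtain ⟨𝓕, h𝓕, hA'⟩ := h A hA
    rw [hA']
    refine Set.subset_sInter fun F hF => Set.sInter_subset_of_mem ⟨h𝓕 F hF, ?_⟩
    refine (Set.sInter_subset_of_mem hA).trans ?_
    rw [hA']
    exact Set.sInter_subset_of_mem hF

theorem IsAlgebraic.union {G : Type*} [AddCommGroup G] {A B : Set G}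
    (hA : IsAlgebraic A) (hB : IsAlgebraic B) : IsAlgebraic (A ∪ B) := by
  obtain ⟨𝓕, h𝓕, rfl⟩ := hA
  obtain ⟨𝓖, h𝓖, rfl⟩ := hB
  refine ⟨{H | ∃ F ∈ 𝓕, ∃ F' ∈ 𝓖, H = F ∪ F'}, ?_, ?_⟩
  · rintro H ⟨F, hF, F', hF', rfl⟩
    exact (h𝓕 F hF).union (h𝓖 F' hF')
  · rw [Set.sInter_union_sInter]
    ext x
    simp only [Set.mem_iInter, Set.mem_sInter, Set.mem_ofPred_eq, Set.mem_prod, Prod.forall]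
    constructor
    · rintro h H ⟨F, hF, F', hF', rfl⟩
      exact h F F' ⟨hF, hF'⟩
    · intro h F F' hFF
      exact h _ ⟨F, hFF.1, F', hFF.2, rfl⟩

/-- The Zariski topology of an abelian group: its closed sets are the algebraic sets. -/
@[reducible]
def zariskiTopology (G : Type*) [AddCommGroup G] : TopologicalSpace G :=
  TopologicalSpace.ofClosed {A : Set G | IsAlgebraic A} isAlgebraic_empty
    (fun 𝓐 h𝓐 => isAlgebraic_sInter 𝓐 fun _ hA => h𝓐 hA)
    (fun _ hA _ hB => IsAlgebraic.union hA hB)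

/-- A precompact group topology: a Hausdorff group topology for which `G` is isomorphic, as a
topological group, to a subgroup of some compact Hausdorff topological group. Such a compact group can always be
taken in the universe of `G`: the closure of the image is a completion of `G`. -/
structure IsPrecompactGroupTopology.{u} {G : Type u} [AddCommGroup G]
    (t : TopologicalSpace G) : Prop where
  isTopologicalAddGroup : @IsTopologicalAddGroup G t _
  t2Space : @T2Space G t
  exists_embedding : ∃ (K : Type u) (_ : AddGroup K) (_ : TopologicalSpace K)
    (_ : IsTopologicalAddGroup K) (_ : CompactSpace K) (_ : T2Space K) (f : G →+ K),
    @Topology.IsEmbedding G K t _ f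

/-- A precompact metric group topology: a precompact group topology generated by a metric. -/
structure IsPrecompactMetricGroupTopology {G : Type*} [AddCommGroup G]
    (t : TopologicalSpace G) : Prop where
  isPrecompact : IsPrecompactGroupTopology t
  metrizableSpace : @TopologicalSpace.MetrizableSpace G t

end MarkovZariski

/-!
Every algebraic set is closed in every Hausdorff group topology on `G`, so a closure in such a
topology is contained in the Zariski closure, and for `#G ≤ 𝔠` the work is to find a precompact
metric topology in which the closures of countably many given sets are large. The topology will be
induced by an injective homomorphism `π` from `G` into a countable power `T` of the circle.

The Zariski closure of a set `X` is covered by finitely many cosets `e 0 + G[n]`, where `G[n]` is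
the `n`-torsion of `G` and `e` is a sequence in `X ∩ (e 0 + G[n])` such that every proper divisor of
`n` (every positive number if `n = 0`) eventually separates its terms
(`exists_isSpread_cover_closure`). It suffices that the points `π (e k - e 0)` are dense in the
`n`-torsion of `T`, for countably many such sequences.

* For a generic homomorphism they are. The homomorphisms `G → T` form a compact space, and density
  is a countable intersection of open conditions, which are dense because a small change of the
  homomorphism moves some term of the sequence to any prescribed place
  (`IsSpread.exists_small_character`): either a homomorphism `G → ℝ` is unbounded on the differences
  `e k - e 0` and a small multiple of it does this, or these have large enough order modulo any given
  finitely generated subgroup. The Baire category theorem gives `exists_hom_closure_range`, with a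
  homomorphism that is also injective on the countable subgroup `H` generated by the sequences.
* Injectivity on all of `G` is arranged without changing the homomorphism `φ` on `H`
  (`exists_injective_extension`). The values of `φ` lie in a countable divisible subgroup `D` of `T`,
  so `φ` extends to `G` with values in `D`. The group `G ⧸ H` embeds into `T`
  (`exists_injective_hom_torus`), and in uncountably many ways with pairwise trivially intersecting
  images, so one of the images meets `D` trivially. The sum of the extension and of this embedding
  is injective.

Conversely, a group with a precompact metric topology injects into the sequences of natural numbers
(`mk_le_continuum_of_isPrecompactMetric`).
-/

namespace MarkovZariski

/-! ### Spread sequences and the Zariski closure -/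

/-- A sequence `e` inside one coset of the `n`-torsion subgroup which is in general position there:
every proper divisor `d` of `n` eventually separates the terms of `e`.
Every positive number is a proper divisor of `n = 0`, so a bound on `d` in terms of the index is
needed to be able to choose the terms one after the other. -/
structure IsSpread {G : Type*} [AddCommGroup G] (n : ℕ) (e : ℕ → G) : Prop where
  torsion : ∀ k, n • (e k - e 0) = 0
  separated : ∀ m k, m < k → ∀ d, d ∣ n → d ≠ n → d ≤ k → d • (e k - e m) ≠ 0

/-- If finitely many cosets of proper torsion subgroups `{x | d x = 0}`, `d ∣ n`, never exhaust `X`,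
a spread sequence can be chosen in `X` greedily. Otherwise `X` is cut into finitely many pieces,
each inside a coset for a proper divisor of `n`, and divisibility on `ℕ` is well founded. -/
theorem exists_finite_cover_isSpread {G : Type*} [AddCommGroup G] (n : ℕ) :
    ∀ (b : G) (X : Set G), X ⊆ {x | n • (x - b) = 0} →
      ∃ F : Set (ℕ × (ℕ → G)), F.Finite ∧
        (∀ p ∈ F, (∀ k, p.2 k ∈ X) ∧ IsSpread p.1 p.2) ∧
        ∀ x ∈ X, ∃ p ∈ F, p.1 • (x - p.2 0) = 0 := by
  induction n using (IsWellFounded.wf (r := DvdNotUnit (α := ℕ))).induction with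
  | _ n ih =>
  intro b X hX
  by_cases h : ∀ s : Finset (ℕ × G), (∀ p ∈ s, p.2 ∈ X) → ∃ q : ℕ × G, q.2 ∈ X ∧
      ∀ p ∈ s, p.1 < q.1 ∧ ∀ d, d ∣ n → d ≠ n → d ≤ q.1 → d • (q.2 - p.2) ≠ 0
  · obtain ⟨f, hf, hr⟩ := exists_seq_of_forall_finset_exists _ _ h
    have hmono : StrictMono fun k => (f k).1 := fun m k hmk => (hr m k hmk).1
    have htor : ∀ x ∈ X, ∀ y ∈ X, n • (x - y) = 0 := by
      intro x hx y hy
      have h1 : n • (x - b) = 0 := hX hx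
      have h2 : n • (y - b) = 0 := hX hy
      rw [← sub_sub_sub_cancel_right x y b, smul_sub, h1, h2, sub_zero]
    refine ⟨{(n, fun k => (f k).2)}, Set.finite_singleton _, ?_, ?_⟩
    · rintro p rfl
      exact ⟨hf, fun k => htor _ (hf k) _ (hf 0),
        fun m k hmk d h1 h2 h3 => (hr m k hmk).2 d h1 h2 (h3.trans (hmono.id_le k))⟩
    · exact fun x hx => ⟨_, rfl, htor _ hx _ (hf 0)⟩
  · push Not at h
    obtain ⟨s, hs, h⟩ := h
    set l := s.sup Prod.fst + 1 with hl
    have hcov : ∀ x ∈ X, ∃ p ∈ s, ∃ d ∈ Finset.range (l + 1),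
        d ∣ n ∧ d ≠ n ∧ d • (x - p.2) = 0 := by
      intro x hx
      obtain ⟨p, hp, h2⟩ := h (l, x) hx
      obtain ⟨d, h3, h4, h5, h6⟩ := h2 (Nat.lt_succ_of_le (Finset.le_sup (f := Prod.fst) hp))
      exact ⟨p, hp, d, Finset.mem_range.2 (Nat.lt_succ_of_le h5), h3, h4, h6⟩
    have key : ∀ (p : ℕ × G) (d : ℕ), ∃ F : Set (ℕ × (ℕ → G)), F.Finite ∧
        (∀ q ∈ F, (∀ k, q.2 k ∈ X) ∧ IsSpread q.1 q.2) ∧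
        (d ∣ n → d ≠ n → ∀ x ∈ X, d • (x - p.2) = 0 → ∃ q ∈ F, q.1 • (x - q.2 0) = 0) := by
      intro p d
      by_cases hd : d ∣ n ∧ d ≠ n
      · obtain ⟨F, h1, h2, h3⟩ := ih d
          (dvdNotUnit_of_dvd_of_not_dvd hd.1 fun h => hd.2 (Nat.dvd_antisymm hd.1 h))
          p.2 {x ∈ X | d • (x - p.2) = 0} (fun x hx => hx.2)
        exact ⟨F, h1, fun q hq => ⟨fun k => ((h2 q hq).1 k).1, (h2 q hq).2⟩,
          fun _ _ x hx hx' => h3 x ⟨hx, hx'⟩⟩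
      · exact ⟨∅, Set.finite_empty, by simp, fun h1 h2 => (hd ⟨h1, h2⟩).elim⟩
    choose F hF1 hF2 hF3 using key
    refine ⟨⋃ p ∈ s, ⋃ d ∈ Finset.range (l + 1), F p d, ?_, ?_, ?_⟩
    · exact Set.Finite.biUnion s.finite_toSet fun p _ =>
        Set.Finite.biUnion (Finset.range (l + 1)).finite_toSet fun d _ => hF1 p d
    · intro q hq
      simp only [Set.mem_iUnion] at hq
      obtain ⟨p, _, d, _, hq⟩ := hq
      exact hF2 p d q hq
    · intro x hx
      obtain ⟨p, hp, d, hd, h1, h2, h3⟩ := hcov x hx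
      obtain ⟨q, hq, hq'⟩ := hF3 p d h1 h2 x hx h3
      refine ⟨q, ?_, hq'⟩
      simp only [Set.mem_iUnion]
      exact ⟨p, hp, d, hd, hq⟩

theorem isClosed_zariski_iff {G : Type*} [AddCommGroup G] {A : Set G} :
    IsClosed[zariskiTopology G] A ↔ IsAlgebraic A := by
  let := zariskiTopology G
  rw [← isOpen_compl_iff]
  change IsAlgebraic (Aᶜᶜ) ↔ _
  rw [compl_compl]

theorem isAlgebraic_iUnion_of_finite {G : Type*} [AddCommGroup G] {F : Set (ℕ × (ℕ → G))}
    (hF : F.Finite) : IsAlgebraic {x | ∃ p ∈ F, p.1 • (x - p.2 0) = 0} := by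
  refine ⟨{{x | ∃ p ∈ F, p.1 • (x - p.2 0) = 0}}, ?_, by simp⟩
  rintro _ rfl
  refine ⟨(fun p : ℕ × (ℕ → G) => {x | p.1 • (x - p.2 0) = 0}) '' F, hF.image _, ?_, ?_⟩
  · rintro _ ⟨p, _, rfl⟩
    refine ⟨p.1, (p.1 : ℤ) • p.2 0, ?_⟩
    ext x
    simp [smul_sub, sub_eq_zero]
  · ext x
    simp

/-- The Zariski closure of `X` is covered by finitely many torsion cosets, each containing a spread
sequence of elements of `X`. -/
theorem exists_isSpread_cover_closure {G : Type*} [AddCommGroup G] (X : Set G) :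
    ∃ F : Set (ℕ × (ℕ → G)), F.Finite ∧
      (∀ p ∈ F, (∀ k, p.2 k ∈ X) ∧ IsSpread p.1 p.2) ∧
      ∀ x ∈ closure[zariskiTopology G] X, ∃ p ∈ F, p.1 • (x - p.2 0) = 0 := by
  obtain ⟨F, h1, h2, h3⟩ := exists_finite_cover_isSpread 0 (0 : G) X (by simp)
  refine ⟨F, h1, h2, fun x hx => ?_⟩
  let := zariskiTopology G
  exact closure_minimal (t := {x | ∃ p ∈ F, p.1 • (x - p.2 0) = 0}) h3
    (isClosed_zariski_iff.2 (isAlgebraic_iUnion_of_finite h1)) hx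

/-- Algebraic sets are closed in every Hausdorff group topology. -/
theorem closure_subset_closure_zariski {G : Type*} [AddCommGroup G] {t : TopologicalSpace G}
    (h1 : @IsTopologicalAddGroup G t _) (h2 : @T2Space G t) (X : Set G) :
    closure[t] X ⊆ closure[zariskiTopology G] X := by
  have hA : IsAlgebraic (closure[zariskiTopology G] X) :=
    isClosed_zariski_iff.1 (@isClosed_closure _ (zariskiTopology G) X)
  have hX : X ⊆ closure[zariskiTopology G] X := @subset_closure _ (zariskiTopology G) X
  generalize closure[zariskiTopology G] X = A at hA hX
  refine closure_minimal hX ?_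
  obtain ⟨𝓕, h𝓕, rfl⟩ := hA
  refine isClosed_sInter fun F hF => ?_
  obtain ⟨S, hS, hE, rfl⟩ := h𝓕 F hF
  rw [Set.sUnion_eq_biUnion]
  refine hS.isClosed_biUnion fun E hE' => ?_
  obtain ⟨n, a, rfl⟩ := hE E hE'
  exact isClosed_eq (continuous_zsmul n) continuous_const

/-! ### Homomorphisms into divisible groups -/

theorem exists_addMonoidHom_apply_eq {Q D : Type*} [AddCommGroup Q] [AddCommGroup D]
    [DivisibleBy D ℤ] (y : Q) (w : D) (h : addOrderOf y • w = 0) : ∃ θ : Q →+ D, θ y = w := by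
  set n := addOrderOf y with hn
  let f : ZMod n →+ Q := ZMod.lift n ⟨zmultiplesHom Q y, by
    simp [hn, addOrderOf_nsmul_eq_zero]⟩
  let g : ZMod n →+ D := ZMod.lift n ⟨zmultiplesHom D w, by simpa using h⟩
  have hf : Function.Injective f := by
    refine (ZMod.lift_injective _).2 fun m hm => ?_
    rw [ZMod.intCast_zmod_eq_zero_iff_dvd]
    exact addOrderOf_dvd_iff_zsmul_eq_zero.2 (by simpa using hm)
  obtain ⟨θ, hθ⟩ := (Module.Baer.of_divisible D).extension_property_addMonoidHom f hf g
  refine ⟨θ, ?_⟩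
  have h1 := DFunLike.congr_fun hθ (1 : ZMod n)
  have h2 : f 1 = y := by
    have := ZMod.lift_coe n ⟨zmultiplesHom Q y, by
      simp [hn, addOrderOf_nsmul_eq_zero]⟩ 1
    simpa using this
  have h3 : g 1 = w := by
    have := ZMod.lift_coe n ⟨zmultiplesHom D w, by simpa using h⟩ 1
    simpa using this
  rw [AddMonoidHom.comp_apply, h2, h3] at h1
  exact h1

theorem exists_addMonoidHom_extending {G D : Type*} [AddCommGroup G] [AddCommGroup D]
    [DivisibleBy D ℤ] (H : AddSubgroup G) (φ : H →+ D) :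
    ∃ ψ : G →+ D, ∀ h : H, ψ h = φ h := by
  obtain ⟨ψ, hψ⟩ := (Module.Baer.of_divisible D).extension_property_addMonoidHom H.subtype
    H.subtype_injective φ
  exact ⟨ψ, fun h => DFunLike.congr_fun hψ h⟩

/-- A homomorphism killing `H` with prescribed value at `y`, as far as the order of `y` modulo `H`
allows. -/
theorem exists_addMonoidHom_vanishing_apply_eq {G D : Type*} [AddCommGroup G] [AddCommGroup D]
    [DivisibleBy D ℤ] (H : AddSubgroup G) (y : G) (w : D)
    (h : addOrderOf (y : G ⧸ H) • w = 0) : ∃ θ : G →+ D, (∀ x ∈ H, θ x = 0) ∧ θ y = w := by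
  obtain ⟨θ, hθ⟩ := exists_addMonoidHom_apply_eq (y : G ⧸ H) w h
  refine ⟨θ.comp (QuotientAddGroup.mk' H), fun x hx => ?_, hθ⟩
  simp [(QuotientAddGroup.eq_zero_iff x).2 hx]

/-! ### Moving a spread sequence by a small character -/

theorem IsSpread.injOn_nsmul {G : Type*} [AddCommGroup G] {n : ℕ} {e : ℕ → G}
    (he : IsSpread n e) {d : ℕ} (h1 : d ∣ n) (h2 : d ≠ n) :
    Set.InjOn (fun k => d • (e k - e 0)) (Set.Ici d) := by
  have key : ∀ m k, d ≤ k → m < k → d • (e k - e 0) ≠ d • (e m - e 0) := by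
    intro m k hk hmk h
    apply he.separated m k hmk d h1 h2 hk
    rw [← sub_sub_sub_cancel_right _ _ (e 0), smul_sub, h, sub_self]
  intro m hm k hk hmk
  rcases lt_trichotomy m k with h | h | h
  · exact (key m k hk h hmk.symm).elim
  · exact h
  · exact (key k m hm h hmk).elim

theorem finite_torsion_of_fg {G : Type*} [AddCommGroup G] {L : AddSubgroup G}
    (hL : L.FG) : Finite (Submodule.torsion ℤ L) := by
  have : AddGroup.FG L := (AddGroup.fg_iff_addSubgroup_fg L).2 hL
  have : Module.Finite ℤ L := Module.Finite.iff_addGroup_fg.2 this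
  exact Module.finite_of_fg_torsion _ (Submodule.torsion_isTorsion)

/-- Homomorphisms to `ℝ` detect infinity of subsets of a finitely generated subgroup. -/
theorem finite_range_of_bounded {G κ : Type*} [AddCommGroup G] {L : AddSubgroup G} (hL : L.FG)
    (z : κ → G) (hz : ∀ k, z k ∈ L) (hb : ∀ c : G →+ ℝ, ∃ B, ∀ k, |c (z k)| ≤ B) :
    (Set.range z).Finite := by
  have : AddGroup.FG L := (AddGroup.fg_iff_addSubgroup_fg L).2 hL
  have : Module.Finite ℤ L := Module.Finite.iff_addGroup_fg.2 this
  have hfin := finite_torsion_of_fg hL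
  let b := Module.finBasis ℤ (L ⧸ Submodule.torsion ℤ L)
  let π := (Submodule.torsion ℤ L).mkQ
  have hcoord : ∀ j, ∃ B : ℤ, ∀ k, |b.repr (π ⟨z k, hz k⟩) j| ≤ B := by
    intro j
    obtain ⟨c, hc⟩ := exists_addMonoidHom_extending L
      ((Int.castAddHom ℝ).comp ((b.coord j).comp π).toAddMonoidHom)
    obtain ⟨B, hB⟩ := hb c
    refine ⟨⌈B⌉, fun k => ?_⟩
    have h1 := hB k
    have h2 : c (z k) = ((b.repr (π ⟨z k, hz k⟩) j : ℤ) : ℝ) := hc ⟨z k, hz k⟩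
    rw [h2, ← Int.cast_abs] at h1
    exact_mod_cast h1.trans (Int.le_ceil B)
  choose B hB using hcoord
  have h1 : (Set.range fun k => b.equivFun (π ⟨z k, hz k⟩)).Finite := by
    refine (Set.finite_Icc (-B) B).subset ?_
    rintro _ ⟨k, rfl⟩
    exact ⟨fun j => (abs_le.1 (hB j k)).1, fun j => (abs_le.1 (hB j k)).2⟩
  have h2 : (Set.range fun k => (⟨z k, hz k⟩ : L)).Finite := by
    refine (h1.preimage' (f := fun x : L => b.equivFun (π x)) ?_).subset ?_
    · rintro v ⟨k, rfl⟩
      refine ((Set.toFinite (Submodule.torsion ℤ L : Set L)).image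
        (fun x => x + ⟨z k, hz k⟩)).subset fun x hx => ?_
      refine ⟨x - ⟨z k, hz k⟩, ?_, by simp⟩
      have hx' : π x = π ⟨z k, hz k⟩ := b.equivFun.injective hx
      exact (Submodule.Quotient.eq _).1 hx'
    · rintro _ ⟨k, rfl⟩
      exact ⟨k, rfl⟩
  refine (h2.image Subtype.val).subset ?_
  rintro _ ⟨k, rfl⟩
  exact ⟨_, ⟨k, rfl⟩, rfl⟩

/-- The `m`-torsion of the circle is `1 / m`-dense; for `m = 0` it is the whole circle. -/
theorem exists_nsmul_eq_zero_norm_sub_lt {N : ℕ} {ε : ℝ} (hN : 1 / (N : ℝ) < ε) (hN0 : 0 < N)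
    {m : ℕ} (hm : m = 0 ∨ N ≤ m) (w : UnitAddCircle) :
    ∃ w' : UnitAddCircle, m • w' = 0 ∧ ‖w' - w‖ < ε := by
  have hNR : (0 : ℝ) < N := by exact_mod_cast hN0
  rcases hm with rfl | hm
  · exact ⟨w, by simp, by simpa using (one_div_pos.2 hNR).trans hN⟩
  · obtain ⟨x, rfl⟩ := QuotientAddGroup.mk_surjective w
    have hmR : (N : ℝ) ≤ m := by exact_mod_cast hm
    have hm0 : (0 : ℝ) < m := hNR.trans_le hmR
    refine ⟨((round (m * x) / m : ℝ) : UnitAddCircle), ?_, ?_⟩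
    · rw [← AddCircle.coe_nsmul, nsmul_eq_mul, mul_div_cancel₀ _ hm0.ne']
      exact (AddCircle.coe_eq_zero_iff 1).2 ⟨round (m * x), by simp⟩
    · refine lt_of_le_of_lt ?_ hN
      change ‖(((round (m * x) / m : ℝ) - x : ℝ) : UnitAddCircle)‖ ≤ _
      refine (QuotientAddGroup.norm_mk_le_norm (S := AddSubgroup.zmultiples (1 : ℝ))).trans ?_
      have h1 : (round (m * x) / m : ℝ) - x = -((m * x - round (m * x)) / m) := by
        field_simp
        ring
      rw [h1, norm_neg, norm_div, Real.norm_eq_abs, Real.norm_eq_abs, abs_of_pos hm0]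
      exact div_le_div₀ zero_le_one ((abs_sub_round _).trans (by norm_num)) hNR hmR

/-- Every `n`-torsion point of the circle is, up to `ε`, the value of an `ε`-small character at a
suitable term of the spread sequence; the term does not depend on the point. -/
theorem IsSpread.exists_small_character {G : Type*} [AddCommGroup G] {n : ℕ} {e : ℕ → G}
    (he : IsSpread n e) (F : Finset G) {ε : ℝ} (hε : 0 < ε) :
    ∃ k, ∀ w : UnitAddCircle, n • w = 0 → ∃ θ : G →+ UnitAddCircle,
      (∀ f ∈ F, ‖θ f‖ < ε) ∧ ‖θ (e k - e 0) - w‖ < ε := by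
  set L := AddSubgroup.closure (F : Set G) with hLdef
  have hL : L.FG := ⟨F, rfl⟩
  have hFL : ∀ f ∈ F, f ∈ L := fun f hf => AddSubgroup.subset_closure hf
  rcases Nat.eq_zero_or_pos n with rfl | hn
  · by_cases hc : ∃ c : G →+ ℝ, ∀ B, ∃ k, B < |c (e k - e 0)|
    · -- the small multiple of `c` which takes the value `w` at a term where `c` is large
      obtain ⟨c, hc⟩ := hc
      obtain ⟨B, hB⟩ : ∃ B, ∀ f ∈ F, |c f| ≤ B :=
        ⟨∑ f ∈ F, |c f|, fun f hf =>
          Finset.single_le_sum (f := fun f => |c f|) (fun _ _ => abs_nonneg _) hf⟩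
      obtain ⟨k, hk⟩ := hc (max (B / ε) 0)
      have hk0 : 0 < |c (e k - e 0)| := (le_max_right _ _).trans_lt hk
      have hkB : B / ε < |c (e k - e 0)| := (le_max_left _ _).trans_lt hk
      refine ⟨k, fun w _ => ?_⟩
      obtain ⟨x, rfl⟩ := QuotientAddGroup.mk_surjective w
      let q : ℝ →+ UnitAddCircle := QuotientAddGroup.mk' _
      have hq : ∀ x : ℝ, ‖q x‖ ≤ |x| := fun x => QuotientAddGroup.norm_mk_le_norm
      have hx : q (Int.fract x) = q x := AddCircle.coe_fract x
      refine ⟨q.comp ((AddMonoidHom.mulLeft (Int.fract x / c (e k - e 0))).comp c), ?_, ?_⟩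
      · intro f hf
        refine (hq _).trans_lt ?_
        change |Int.fract x / c (e k - e 0) * c f| < ε
        rw [abs_mul, abs_div, div_mul_eq_mul_div, div_lt_iff₀ hk0]
        rw [div_lt_iff₀ hε] at hkB
        have h1 : |Int.fract x| ≤ 1 := by
          rw [abs_of_nonneg (Int.fract_nonneg x)]
          exact (Int.fract_lt_one x).le
        have h2 : |Int.fract x| * |c f| ≤ 1 * |c f| :=
          mul_le_mul_of_nonneg_right h1 (abs_nonneg _)
        have h3 := hB f hf
        linarith
      · change ‖q (Int.fract x / c (e k - e 0) * c (e k - e 0)) - q x‖ < ε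
        rw [div_mul_cancel₀ _ (abs_pos.1 hk0), hx]
        simpa using hε
    · -- the orders of the terms modulo `L` are unbounded
      push Not at hc
      obtain ⟨N, hN⟩ := exists_nat_one_div_lt hε
      have hN' : 1 / ((N + 1 : ℕ) : ℝ) < ε := by exact_mod_cast hN
      obtain ⟨k, hk⟩ : ∃ k, addOrderOf ((e k - e 0 : G) : G ⧸ L) = 0 ∨
          N + 1 ≤ addOrderOf ((e k - e 0 : G) : G ⧸ L) := by
        by_contra! hcon
        have hmem : ∀ k, (N + 1).factorial • (e k - e 0) ∈ L := by
          intro k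
          rw [← QuotientAddGroup.eq_zero_iff]
          change (N + 1).factorial • ((e k - e 0 : G) : G ⧸ L) = 0
          exact addOrderOf_dvd_iff_nsmul_eq_zero.1
            (Nat.dvd_factorial (Nat.pos_of_ne_zero (hcon k).1) (hcon k).2.le)
        have hfin := finite_range_of_bounded hL _ hmem fun c => by
          obtain ⟨B, hB⟩ := hc ((N + 1).factorial • c)
          refine ⟨B, fun k => ?_⟩
          simpa using hB k
        exact ((Set.Ici_infinite (N + 1).factorial).image (he.injOn_nsmul (dvd_zero _)
          (Nat.factorial_ne_zero _))) (hfin.subset (Set.image_subset_range _ _))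
      refine ⟨k, fun w _ => ?_⟩
      obtain ⟨w', h1, h2⟩ := exists_nsmul_eq_zero_norm_sub_lt hN' N.succ_pos hk w
      obtain ⟨θ, h3, h4⟩ := exists_addMonoidHom_vanishing_apply_eq L _ w' h1
      exact ⟨θ, fun f hf => by simpa [h3 f (hFL f hf)] using hε, by rwa [h4]⟩
  · -- some term has order exactly `n` modulo `L`, since the torsion of `L` is finite
    have hfin : {x : G | x ∈ L ∧ n • x = 0}.Finite := by
      have := finite_torsion_of_fg hL
      refine ((Set.toFinite (Submodule.torsion ℤ L : Set L)).image Subtype.val).subset ?_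
      rintro x ⟨hx, hx'⟩
      refine ⟨⟨x, hx⟩, ?_, rfl⟩
      refine (Submodule.mem_torsion_iff _).2
        ⟨⟨(n : ℤ), mem_nonZeroDivisors_of_ne_zero (by exact_mod_cast hn.ne')⟩, ?_⟩
      ext
      simpa using hx'
    have hbad : {k | n ≤ k ∧ ∃ d ∈ n.properDivisors, d • (e k - e 0) ∈ L}.Finite := by
      have h1 : (⋃ d ∈ n.properDivisors, {k | n ≤ k ∧ d • (e k - e 0) ∈ L}).Finite := by
        refine Set.Finite.biUnion n.properDivisors.finite_toSet fun d hd => ?_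
        obtain ⟨hdn, hlt⟩ := Nat.mem_properDivisors.1 hd
        refine Set.Finite.of_finite_image (f := fun k => d • (e k - e 0)) (hfin.subset ?_)
          ((he.injOn_nsmul hdn hlt.ne).mono fun k hk => hlt.le.trans hk.1)
        rintro _ ⟨k, ⟨_, hk⟩, rfl⟩
        exact ⟨hk, by rw [smul_comm, he.torsion, smul_zero]⟩
      refine h1.subset ?_
      rintro k ⟨hk, d, hd, hdk⟩
      simp only [Set.mem_iUnion]
      exact ⟨d, hd, hk, hdk⟩
    obtain ⟨k, hk, hk'⟩ := ((Set.Ici_infinite n).sdiff hbad).nonempty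
    have hord : addOrderOf ((e k - e 0 : G) : G ⧸ L) = n := by
      have h1 : addOrderOf ((e k - e 0 : G) : G ⧸ L) ∣ n := by
        refine addOrderOf_dvd_iff_nsmul_eq_zero.2 ?_
        change ((n • (e k - e 0) : G) : G ⧸ L) = 0
        rw [he.torsion, QuotientAddGroup.mk_zero]
      by_contra h2
      refine hk' ⟨hk, _, Nat.mem_properDivisors.2
        ⟨h1, lt_of_le_of_ne (Nat.le_of_dvd hn h1) h2⟩, ?_⟩
      rw [← QuotientAddGroup.eq_zero_iff]
      exact addOrderOf_nsmul_eq_zero ((e k - e 0 : G) : G ⧸ L)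
    refine ⟨k, fun w hw => ?_⟩
    obtain ⟨θ, h3, h4⟩ := exists_addMonoidHom_vanishing_apply_eq L (e k - e 0) w (by rwa [hord])
    exact ⟨θ, fun f hf => by simpa [h3 f (hFL f hf)] using hε, by simpa [h4] using hε⟩

/-! ### Generic homomorphisms into a torus -/

theorem exists_character_ne_zero {G : Type*} [AddCommGroup G] {h : G} (hh : h ≠ 0) :
    ∃ χ : G →+ UnitAddCircle, χ h ≠ 0 := by
  obtain ⟨w, hw, hw'⟩ : ∃ w : UnitAddCircle, addOrderOf h • w = 0 ∧ w ≠ 0 := by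
    rcases Nat.eq_zero_or_pos (addOrderOf h) with h0 | h0
    · refine ⟨((1 / 2 : ℝ) : UnitAddCircle), by simp [h0], fun h => ?_⟩
      obtain ⟨m, hm⟩ := (AddCircle.coe_eq_zero_iff 1).1 h
      have h1 : ((2 * m : ℤ) : ℝ) = (1 : ℤ) := by
        simp only [zsmul_eq_mul, mul_one] at hm
        push_cast
        linarith
      have h2 : 2 * m = 1 := by exact_mod_cast h1
      omega
    · have ho : addOrderOf (((1 : ℝ) / addOrderOf h : ℝ) : UnitAddCircle) = addOrderOf h :=
        AddCircle.addOrderOf_period_div h0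
      refine ⟨_, by rw [← ho]; exact addOrderOf_nsmul_eq_zero _, fun h2 => hh ?_⟩
      rw [h2, addOrderOf_zero] at ho
      exact AddMonoid.addOrderOf_eq_one_iff.1 ho.symm
  obtain ⟨χ, hχ⟩ := exists_addMonoidHom_apply_eq h w hw
  exact ⟨χ, hχ ▸ hw'⟩

theorem exists_finset_ball_subset_of_isOpen {κ X : Type*} [PseudoMetricSpace X] {W : Set (κ → X)}
    (hW : IsOpen W) {f : κ → X} (hf : f ∈ W) :
    ∃ (I : Finset κ) (ε : ℝ), 0 < ε ∧ ∀ g : κ → X, (∀ a ∈ I, dist (g a) (f a) < ε) → g ∈ W := by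
  obtain ⟨I, u, h1, h2⟩ := isOpen_pi_iff.1 hW f hf
  have h3 : ∀ a ∈ I, ∀ᶠ ε in 𝓝[>] (0 : ℝ), Metric.ball (f a) ε ⊆ u a := by
    intro a ha
    obtain ⟨δ, hδ, hsub⟩ := Metric.isOpen_iff.1 (h1 a ha).1 (f a) (h1 a ha).2
    filter_upwards [Ioo_mem_nhdsGT hδ] with ε hε
    exact (Metric.ball_subset_ball hε.2.le).trans hsub
  obtain ⟨ε, h4, h5⟩ := (((Finset.eventually_all I).2 h3).and self_mem_nhdsWithin).exists
  exact ⟨I, ε, h5, fun g hg => h2 fun a ha => h4 a ha (hg a ha)⟩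

/-- The homomorphisms `G → (ι → ℝ/ℤ)`, in uncurried form, as a subset of a compact product of
circles. -/
def torusHoms (G ι : Type*) [AddCommGroup G] : Set (G × ι → UnitAddCircle) :=
  {f | ∀ x y i, f (x + y, i) = f (x, i) + f (y, i)}

theorem isClosed_torusHoms (G ι : Type*) [AddCommGroup G] : IsClosed (torusHoms G ι) := by
  simp only [torusHoms, Set.ofPred_forall]
  exact isClosed_iInter fun x => isClosed_iInter fun y => isClosed_iInter fun i =>
    isClosed_eq (by fun_prop) (by fun_prop)

/-- The homomorphism given by a point of `torusHoms G ι`. -/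
def torusHoms.toHom {G ι : Type*} [AddCommGroup G] (f : torusHoms G ι) :
    G →+ (ι → UnitAddCircle) :=
  AddMonoidHom.mk' (fun g i => f.1 (g, i)) fun x y => funext fun i => f.2 x y i

/-- A family of characters is a point of `torusHoms G ι`. -/
def torusHoms.ofCharacters {G ι : Type*} [AddCommGroup G] (χ : ι → G →+ UnitAddCircle) :
    torusHoms G ι :=
  ⟨fun p => χ p.2 p.1, fun x y i => map_add (χ i) x y⟩

theorem torusHoms.continuous_toHom_apply {G ι : Type*} [AddCommGroup G] (g : G) :
    Continuous fun f : torusHoms G ι => toHom f g :=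
  continuous_pi fun i => (continuous_apply (g, i)).comp continuous_subtype_val

theorem torusHoms.dense_of_forall {G ι : Type*} [AddCommGroup G] {O : Set (torusHoms G ι)}
    (h : ∀ (ψ : ι → G →+ UnitAddCircle) (I : Finset (G × ι)) (ε : ℝ), 0 < ε →
      ∃ χ : ι → G →+ UnitAddCircle, (∀ p ∈ I, ‖χ p.2 p.1 - ψ p.2 p.1‖ < ε) ∧
        ofCharacters χ ∈ O) : Dense O := by
  rw [dense_iff_inter_open]
  rintro W hW ⟨f, hf⟩
  obtain ⟨W, hW', rfl⟩ := isOpen_induced_iff.1 hW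
  obtain ⟨I, ε, hε, hI⟩ := exists_finset_ball_subset_of_isOpen hW' hf
  obtain ⟨χ, h1, h2⟩ := h (fun i => (Pi.evalAddMonoidHom _ i).comp (toHom f)) I ε hε
  refine ⟨ofCharacters χ, hI _ fun p hp => ?_, h2⟩
  rw [dist_eq_norm]
  exact h1 p hp

theorem torusHoms.dense_ne_zero {G ι : Type*} [AddCommGroup G] [Infinite ι] {h : G} (hh : h ≠ 0) :
    Dense {f : torusHoms G ι | toHom f h ≠ 0} := by
  classical
  refine dense_of_forall fun ψ I ε hε => ?_
  obtain ⟨j, hj⟩ := Infinite.exists_notMem_finset (I.image Prod.snd)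
  obtain ⟨χ, hχ⟩ := exists_character_ne_zero hh
  refine ⟨Function.update ψ j χ, fun p hp => ?_, fun h0 => hχ ?_⟩
  · have hpj : p.2 ≠ j := fun hpj => hj (hpj ▸ Finset.mem_image_of_mem _ hp)
    simpa [Function.update_of_ne hpj] using hε
  · have : Function.update ψ j χ j h = 0 := congrFun h0 j
    simpa using this

theorem torusHoms.dense_exists_mem {G ι : Type*} [AddCommGroup G] {n : ℕ} {e : ℕ → G}
    (he : IsSpread n e) {U : Set (ι → UnitAddCircle)} (hU : IsOpen U)
    (hne : ∃ u ∈ U, n • u = 0) :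
    Dense {f : torusHoms G ι | ∃ k, toHom f (e k - e 0) ∈ U} := by
  classical
  obtain ⟨u, hu, hnu⟩ := hne
  obtain ⟨J, δ, hδ, hJ⟩ := exists_finset_ball_subset_of_isOpen hU hu
  refine dense_of_forall fun ψ I ε hε => ?_
  obtain ⟨k, hk⟩ := he.exists_small_character (I.image Prod.fst) (lt_min hε hδ)
  have hw : ∀ i, n • (u i - ψ i (e k - e 0)) = 0 := by
    intro i
    rw [smul_sub, ← map_nsmul, he.torsion, map_zero, sub_zero]
    exact congrFun hnu i
  choose θ h1 h2 using fun i => hk _ (hw i)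
  refine ⟨fun i => ψ i + θ i, fun p hp => ?_, k, hJ _ fun j _ => ?_⟩
  · simpa using (h1 p.2 p.1 (Finset.mem_image_of_mem _ hp)).trans_le (min_le_left _ _)
  · rw [dist_eq_norm]
    have h3 := (h2 j).trans_le (min_le_right _ _)
    change ‖ψ j (e k - e 0) + θ j (e k - e 0) - u j‖ < δ
    rwa [sub_sub_eq_add_sub, add_comm] at h3

/-- By the Baire category theorem, countably many spread sequences can be made dense in the torsion
of the torus by a single homomorphism, which moreover is nonzero at countably many given points. -/
theorem exists_hom_closure_range {G ι : Type*} [AddCommGroup G] [Countable ι] [Infinite ι]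
    {S : Set (ℕ × (ℕ → G))} (hS : S.Countable) (hspread : ∀ p ∈ S, IsSpread p.1 p.2)
    {H : Set G} (hH : H.Countable) :
    ∃ φ : G →+ (ι → UnitAddCircle), (∀ h ∈ H, h ≠ 0 → φ h ≠ 0) ∧
      ∀ p ∈ S, ∀ w : ι → UnitAddCircle, p.1 • w = 0 →
        w ∈ closure (Set.range fun k => φ (p.2 k - p.2 0)) := by
  have : CompactSpace (torusHoms G ι) := isCompact_iff_compactSpace.1
    (isClosed_torusHoms G ι).isCompact
  have : Countable S := hS
  have : Countable H := hH
  let 𝓑 := TopologicalSpace.countableBasis (ι → UnitAddCircle)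
  have : Countable 𝓑 := (TopologicalSpace.countable_countableBasis _)
  let O₁ : {h : H // h.1 ≠ 0} → Set (torusHoms G ι) := fun h => {f | torusHoms.toHom f h.1 ≠ 0}
  let O₂ : {q : S × 𝓑 // ∃ u ∈ q.2.1, q.1.1.1 • u = 0} → Set (torusHoms G ι) := fun q =>
    {f | ∃ k, torusHoms.toHom f (q.1.1.1.2 k - q.1.1.1.2 0) ∈ q.1.2.1}
  have hB : ∀ U : 𝓑, IsOpen U.1 := fun U =>
    TopologicalSpace.isOpen_of_mem_countableBasis U.2
  have hdense : Dense (⋂ a, Sum.elim O₁ O₂ a) := by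
    refine dense_iInter_of_isOpen ?_ ?_
    · rintro (h | q)
      · exact isOpen_ne.preimage (torusHoms.continuous_toHom_apply _)
      · change IsOpen {f | ∃ k, _}
        rw [Set.ofPred_exists]
        exact isOpen_iUnion fun k => (hB q.1.2).preimage (torusHoms.continuous_toHom_apply _)
    · rintro (h | q)
      · exact torusHoms.dense_ne_zero h.2
      · exact torusHoms.dense_exists_mem (hspread _ q.1.1.2) (hB q.1.2) q.2
  have : Nonempty (torusHoms G ι) := ⟨torusHoms.ofCharacters 0⟩
  obtain ⟨f, hf⟩ := hdense.nonempty
  rw [Set.mem_iInter] at hf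
  refine ⟨torusHoms.toHom f, fun h hh h0 => hf (Sum.inl ⟨⟨h, hh⟩, h0⟩), fun p hp w hw => ?_⟩
  refine (TopologicalSpace.isBasis_countableBasis _).mem_closure_iff.2 fun U hU hwU => ?_
  obtain ⟨k, hk⟩ := hf (Sum.inr ⟨(⟨p, hp⟩, ⟨U, hU⟩), w, hwU, hw⟩)
  exact ⟨_, hk, k, rfl⟩

/-! ### Embedding groups of size at most the continuum into a torus -/

theorem exists_addMonoidHom_pi_extending {G ι : Type*} [AddCommGroup G] (H : AddSubgroup G)
    (φ : H →+ (ι → UnitAddCircle)) : ∃ ψ : G →+ (ι → UnitAddCircle), ∀ h : H, ψ h = φ h := by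
  choose ψ hψ using fun i =>
    exists_addMonoidHom_extending H ((Pi.evalAddMonoidHom (fun _ : ι => UnitAddCircle) i).comp φ)
  exact ⟨AddMonoidHom.mk' (fun g i => ψ i g) fun x y => funext fun i => map_add (ψ i) x y,
    fun h => funext fun i => hψ i h⟩

/-- The space `ℕ → K` of sequences over a countable field has dimension `𝔠`. -/
theorem exists_injective_hom_sequences (K : Type) {V : Type*} [Field K] [Countable K]
    [AddCommGroup V] [Module K V] (hV : #V ≤ 𝔠) :
    ∃ g : V →+ (ℕ → K), Function.Injective g := by
  suffices h : Cardinal.lift.{0} (Module.rank K V) ≤ Cardinal.lift (Module.rank K (ℕ → K)) by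
    obtain ⟨g, hg⟩ := lift_rank_le_iff_exists_linearMap.1 h
    exact ⟨g.toAddMonoidHom, hg⟩
  rw [rank_fun_infinite]
  have h1 : #(ℕ → K) = 𝔠 := by
    rw [← Cardinal.power_def, Cardinal.mk_nat]
    exact Cardinal.power_aleph0_of_le_continuum (Cardinal.two_le_iff.2 ⟨0, 1, zero_ne_one⟩)
      (Cardinal.mk_le_aleph0.trans Cardinal.aleph0_le_continuum)
  rw [h1, Cardinal.lift_continuum, Cardinal.lift_uzero]
  exact (rank_le_card _ _).trans hV

theorem exists_injective_hom_torus_of_prime_exponent {V : Type*} [AddCommGroup V] (hV : #V ≤ 𝔠)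
    (p : ℕ) [Fact p.Prime] (hp : ∀ x : V, p • x = 0) :
    ∃ φ : V →+ (ℕ → UnitAddCircle), Function.Injective φ := by
  let : Module (ZMod p) V := AddCommGroup.zmodModule hp
  obtain ⟨g, hg⟩ := exists_injective_hom_sequences (ZMod p) hV
  refine ⟨AddMonoidHom.mk' (fun v i => ZMod.toAddCircle (g v i))
    fun x y => funext fun i => by simp, fun x y hxy => hg (funext fun i => ?_)⟩
  exact ZMod.toAddCircle_injective p (congrFun hxy i)

theorem exists_hom_injective_on_prime_torsion {A : Type*} [AddCommGroup A] (hA : #A ≤ 𝔠) (p : ℕ)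
    [Fact p.Prime] :
    ∃ f : A →+ (ℕ → UnitAddCircle), ∀ a : A, p • a = 0 → f a = 0 → a = 0 := by
  let H : AddSubgroup A := (nsmulAddMonoidHom (α := A) p).ker
  obtain ⟨φ, hφ⟩ := exists_injective_hom_torus_of_prime_exponent
    ((Cardinal.mk_le_of_injective H.subtype_injective).trans hA) p fun x => Subtype.ext x.2
  obtain ⟨f, hf⟩ := exists_addMonoidHom_pi_extending H φ
  refine ⟨f, fun a ha h0 => ?_⟩
  have h1 : φ ⟨a, ha⟩ = 0 := (hf ⟨a, ha⟩).symm.trans h0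
  exact congrArg Subtype.val (hφ (h1.trans (map_zero φ).symm))

theorem exists_hom_real_ker_torsion {A : Type*} [AddCommGroup A] (hA : #A ≤ 𝔠) :
    ∃ f : A →+ ℝ, ∀ a : A, f a = 0 → ∃ n : ℤ, n ≠ 0 ∧ n • a = 0 := by
  obtain ⟨s, hs, hmax⟩ := exists_maximal_linearIndepOn ℤ (id : A → A)
  have hfree : Module.Free ℤ (Submodule.span ℤ (Set.range fun x : s => id x.1)) :=
    Module.Free.of_basis (Module.Basis.span hs)
  let b := Module.Free.chooseBasis ℚ ℝ
  have hb : LinearIndependent ℤ b := b.linearIndependent.restrict_scalars' ℤ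
  obtain ⟨g, hg⟩ := Module.Free.exists_linearMap_injective_of_linearIndependent_of_lift_rank_le
    (M := Submodule.span ℤ (Set.range fun x : s => id x.1)) hb (by
      rw [← Module.Free.rank_eq_card_chooseBasisIndex, Real.rank_rat_real,
        Cardinal.lift_continuum, Cardinal.lift_uzero]
      exact (rank_le_card _ _).trans
        ((Cardinal.mk_le_of_injective Subtype.val_injective).trans hA))
  obtain ⟨f, hf⟩ := exists_addMonoidHom_extending (D := ℝ)
    ((Submodule.span ℤ (Set.range fun x : s => id x.1)).toAddSubgroup)
    g.toAddMonoidHom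
  refine ⟨f, fun a ha => ?_⟩
  obtain ⟨n, hn, hna⟩ : ∃ n : ℤ, n ≠ 0 ∧
      n • a ∈ Submodule.span ℤ (Set.range fun x : s => id x.1) := by
    by_cases has : a ∈ s
    · exact ⟨1, one_ne_zero, by
        rw [one_smul]; exact Submodule.subset_span ⟨⟨a, has⟩, rfl⟩⟩
    · obtain ⟨n, hn, h⟩ := hmax a has
      exact ⟨n, hn, by simpa [Set.image_eq_range] using h⟩
  refine ⟨n, hn, ?_⟩
  have h1 : g ⟨n • a, hna⟩ = 0 := (hf ⟨n • a, hna⟩).symm.trans (by simp [ha])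
  exact congrArg Subtype.val (hg (h1.trans (map_zero g).symm))

theorem exists_real_hom_torus_injective :
    ∃ f : ℝ →+ (ℕ → UnitAddCircle), Function.Injective f := by
  refine ⟨AddMonoidHom.mk' (fun x j => ((x / (j + 1) : ℝ) : UnitAddCircle))
    fun x y => funext fun j => ?_, ?_⟩
  · simp [add_div]
  · refine (injective_iff_map_eq_zero _).2 fun x hx => ?_
    obtain ⟨j, hj⟩ := exists_nat_gt |x|
    obtain ⟨m, hm⟩ := (AddCircle.coe_eq_zero_iff 1).1 (congrFun hx j)
    have hj0 : (0 : ℝ) < j + 1 := by positivity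
    simp only [zsmul_eq_mul, mul_one] at hm
    have h1 : |(m : ℝ)| < 1 := by
      rw [hm, abs_div, abs_of_pos hj0, div_lt_one hj0]
      linarith
    have h2 : m = 0 := Int.abs_lt_one_iff.1 (by exact_mod_cast h1)
    rw [h2, Int.cast_zero, eq_comm, div_eq_zero_iff] at hm
    exact hm.resolve_right hj0.ne'

/-- A nonzero element of the intersection of the kernels would be torsion, and then some multiple of
it would have prime order. -/
theorem exists_injective_hom_torus {A : Type*} [AddCommGroup A] (hA : #A ≤ 𝔠) :
    ∃ f : A →+ (ℕ → UnitAddCircle), Function.Injective f := by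
  obtain ⟨r, hr⟩ := exists_hom_real_ker_torsion hA
  obtain ⟨i, hi⟩ := exists_real_hom_torus_injective
  have htor : ∀ p : Nat.Primes, ∃ f : A →+ (ℕ → UnitAddCircle),
      ∀ a : A, p.1 • a = 0 → f a = 0 → a = 0 := fun p => by
    have : Fact p.1.Prime := ⟨p.2⟩
    exact exists_hom_injective_on_prime_torsion hA p.1
  choose t ht using htor
  obtain ⟨σ, hσ⟩ := exists_surjective_nat (Option Nat.Primes × ℕ)
  let F : Option Nat.Primes → A →+ (ℕ → UnitAddCircle) := fun o => o.elim (i.comp r) t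
  refine ⟨AddMonoidHom.mk' (fun a k => F (σ k).1 a (σ k).2)
    fun x y => funext fun k => by simp, ?_⟩
  refine (injective_iff_map_eq_zero _).2 fun a ha => ?_
  have hF : ∀ o, F o a = 0 := fun o => funext fun j => by
    obtain ⟨k, hk⟩ := hσ (o, j)
    have h1 : F (σ k).1 a (σ k).2 = 0 := congrFun ha k
    rwa [hk] at h1
  by_contra hne
  have h1 : r a = 0 := hi ((hF none).trans (map_zero i).symm)
  obtain ⟨n, hn, hna⟩ := hr a h1
  have hfin : 0 < addOrderOf a :=
    (isOfFinAddOrder_iff_zsmul_eq_zero.2 ⟨n, hn, hna⟩).addOrderOf_pos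
  obtain ⟨p, hp, q, hq⟩ := Nat.exists_prime_and_dvd
    (fun h => hne (AddMonoid.addOrderOf_eq_one_iff.1 h) : addOrderOf a ≠ 1)
  have hq0 : 0 < q := Nat.pos_of_ne_zero fun h => by simp [hq, h] at hfin
  let P : Nat.Primes := ⟨p, hp⟩
  have htP : t P a = 0 := hF (some P)
  have h2 : q • a = 0 := ht P (q • a)
    (by rw [← mul_smul, ← hq, addOrderOf_nsmul_eq_zero])
    (by rw [map_nsmul, htP, smul_zero])
  have h3 := Nat.le_of_dvd hq0 (addOrderOf_dvd_iff_nsmul_eq_zero.2 h2)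
  have h4 := hp.two_le
  nlinarith

/-! ### Injective extension of homomorphisms -/

theorem countable_addSubgroup_closure {G : Type*} [AddCommGroup G] {S : Set G}
    (hS : S.Countable) : (AddSubgroup.closure S : Set G).Countable := by
  have : Countable S := hS
  let f : (S →₀ ℤ) →+ G := Finsupp.liftAddHom fun s => zmultiplesHom G s.1
  have h : AddSubgroup.closure S ≤ f.range := (AddSubgroup.closure_le _).2 fun s hs =>
    ⟨Finsupp.single ⟨s, hs⟩ 1, by simp [f]⟩
  exact (Set.countable_range f).mono h

/-- The image of `S →₀ ℚ` under a homomorphism taking the basis vectors to the elements of `S`. -/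
theorem exists_countable_divisible_addSubgroup {M : Type*} [AddCommGroup M] [DivisibleBy M ℤ]
    {S : Set M} (hS : S.Countable) :
    ∃ D : AddSubgroup M, S ⊆ D ∧ (D : Set M).Countable ∧
      ∀ n : ℤ, n ≠ 0 → ∀ x ∈ D, ∃ y ∈ D, n • y = x := by
  have : Countable S := hS
  choose g hg using fun s : S => exists_addMonoidHom_apply_eq (1 : ℚ) s.1 (by
    rw [addOrderOf_eq_zero_iff'.2 fun n hn => by simpa using hn.ne', zero_smul])
  let f : (S →₀ ℚ) →+ M := Finsupp.liftAddHom g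
  refine ⟨f.range, fun s hs => ⟨Finsupp.single ⟨s, hs⟩ 1, ?_⟩, ?_, ?_⟩
  · simp [f, hg]
  · rw [AddMonoidHom.coe_range]
    exact Set.countable_range f
  · rintro n hn _ ⟨u, rfl⟩
    refine ⟨_, ⟨(n : ℚ)⁻¹ • u, rfl⟩, ?_⟩
    have hn' : (n : ℚ) ≠ 0 := by exact_mod_cast hn
    rw [← map_zsmul, ← Int.cast_smul_eq_zsmul ℚ, smul_smul, mul_inv_cancel₀ hn', one_smul]

/-- The homomorphism with block `0` equal to `θ` and block `k + 1` equal to `θ` or `0` according to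
the bit `s k`. For injective `θ` and different `s` the images meet trivially. -/
def blockHom {A : Type*} [AddCommGroup A] (θ : A →+ (ℕ → UnitAddCircle)) (s : ℕ → Bool) :
    A →+ (ℕ × ℕ → UnitAddCircle) :=
  AddMonoidHom.mk' (fun a p => Nat.casesOn p.1 (θ a p.2) fun k => if s k then θ a p.2 else 0) <| by
    rintro x y
    ext ⟨_ | k, j⟩
    · simp
    · by_cases h : s k <;> simp [h]

/-- A point `blockHom θ s a` with `θ a ≠ 0` determines `s`, and there are uncountably many `s`. -/
theorem exists_blockHom_notMem {A : Type*} [AddCommGroup A] (θ : A →+ (ℕ → UnitAddCircle))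
    {D : Set (ℕ × ℕ → UnitAddCircle)} (hD : D.Countable) :
    ∃ s : ℕ → Bool, ∀ a, blockHom θ s a ∈ D → θ a = 0 := by
  by_contra! hcon
  choose a haD ha using hcon
  have hinj : Function.Injective fun s => (⟨blockHom θ s (a s), haD s⟩ : D) := by
    intro s t hst
    have h1 : blockHom θ s (a s) = blockHom θ t (a t) := congrArg Subtype.val hst
    have h2 : θ (a s) = θ (a t) := funext fun j => congrFun h1 (0, j)
    ext k
    by_contra hk
    have h3 : ∀ j, (if s k then θ (a s) j else 0) = if t k then θ (a t) j else 0 :=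
      fun j => congrFun h1 (k + 1, j)
    rw [← h2] at h3
    apply ha s
    ext j
    have h4 := h3 j
    cases hs : s k <;> cases ht : t k <;> simp_all
  have : Countable D := hD
  have h1 : Countable (ℕ → Bool) := hinj.countable
  have h2 : #(ℕ → Bool) ≤ ℵ₀ := Cardinal.mk_le_aleph0
  rw [← Cardinal.power_def, Cardinal.mk_bool, Cardinal.mk_nat, Cardinal.two_power_aleph0] at h2
  exact h2.not_gt Cardinal.aleph0_lt_continuum

/-- Extend `φ` with values in a countable divisible group `D`, and correct the extension on `G ⧸ H`
by an embedding whose image meets `D` trivially. -/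
theorem exists_injective_extension {G : Type*} [AddCommGroup G] (hG : #G ≤ 𝔠) {H : AddSubgroup G}
    (hH : (H : Set G).Countable) (φ : H →+ (ℕ × ℕ → UnitAddCircle))
    (hφ : Function.Injective φ) :
    ∃ π : G →+ (ℕ × ℕ → UnitAddCircle), Function.Injective π ∧ ∀ h : H, π h = φ h := by
  have : Countable H := hH
  obtain ⟨D, h1, h2, h3⟩ := exists_countable_divisible_addSubgroup (Set.countable_range φ)
  let : DivisibleBy D ℤ := divisibleByOfSMulRightSurj D ℤ fun {n} hn x => by
    obtain ⟨y, hy, hyx⟩ := h3 n hn x x.2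
    exact ⟨⟨y, hy⟩, Subtype.ext hyx⟩
  obtain ⟨φ', hφ'⟩ := exists_addMonoidHom_extending H
    (φ.codRestrict D fun h => h1 ⟨h, rfl⟩)
  obtain ⟨θ, hθ⟩ := exists_injective_hom_torus (A := G ⧸ H)
    ((Cardinal.mk_le_of_surjective (QuotientAddGroup.mk_surjective (s := H))).trans hG)
  obtain ⟨s, hs⟩ := exists_blockHom_notMem θ h2
  let ψ := (blockHom θ s).comp (QuotientAddGroup.mk' H)
  have hπH : ∀ h : H, (D.subtype.comp φ' + ψ) h = φ h := by
    intro h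
    have h4 : ψ h = 0 := by
      change blockHom θ s ((h : G) : G ⧸ H) = 0
      rw [(QuotientAddGroup.eq_zero_iff (h : G)).2 h.2, map_zero]
    rw [AddMonoidHom.add_apply, h4, add_zero]
    exact congrArg Subtype.val (hφ' h)
  refine ⟨D.subtype.comp φ' + ψ, (injective_iff_map_eq_zero _).2 fun g hg => ?_, hπH⟩
  have h5 : blockHom θ s (g : G ⧸ H) ∈ D := by
    have : blockHom θ s (g : G ⧸ H) = -(φ' g : ℕ × ℕ → UnitAddCircle) :=
      eq_neg_of_add_eq_zero_right hg
    rw [this]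
    exact D.neg_mem (φ' g).2
  have h6 : g ∈ H := (QuotientAddGroup.eq_zero_iff g).1
    (hθ ((hs _ h5).trans (map_zero θ).symm))
  have h7 : φ ⟨g, h6⟩ = 0 := (hπH ⟨g, h6⟩).symm.trans hg
  exact congrArg Subtype.val (hφ (h7.trans (map_zero φ).symm))

/-! ### Precompact metric group topologies -/

theorem isPrecompactMetricGroupTopology_induced.{u} {G : Type u} {ι : Type} [AddCommGroup G]
    [Countable ι] (π : G →+ (ι → UnitAddCircle)) (hπ : Function.Injective π) :
    IsPrecompactMetricGroupTopology (TopologicalSpace.induced π inferInstance) := by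
  let : TopologicalSpace G := TopologicalSpace.induced π inferInstance
  have hemb : Topology.IsEmbedding π := ⟨⟨rfl⟩, hπ⟩
  refine ⟨⟨topologicalAddGroup_induced π, hemb.t2Space, ?_⟩, hemb.metrizableSpace⟩
  exact ⟨ULift.{u} (ι → UnitAddCircle), inferInstance, inferInstance,
    topologicalAddGroup_induced (AddEquiv.ulift (α := ι → UnitAddCircle)), inferInstance,
    inferInstance, AddEquiv.ulift.symm.toAddMonoidHom.comp π,
    Homeomorph.ulift.symm.isEmbedding.comp hemb⟩

/-- A point is determined by its position in finite covers of the compact group by translates of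
smaller and smaller neighbourhoods of zero. -/
theorem mk_le_continuum_of_isPrecompactMetric {G : Type*} [AddCommGroup G]
    {t : TopologicalSpace G} (ht : IsPrecompactMetricGroupTopology t) : #G ≤ 𝔠 := by
  obtain ⟨⟨_, _, K, _, _, _, _, _, f, hf⟩, _⟩ := ht
  obtain ⟨U, hU⟩ := (𝓝 (0 : G)).exists_antitone_basis
  have hcov : ∀ n, ∃ c : G → K, (Set.range c).Finite ∧ ∀ x y, c x = c y → -x + y ∈ U n := by
    intro n
    obtain ⟨V₀, hV₀, hV₀U⟩ := (hf.isInducing.nhds_eq_comap 0 ▸ hU.mem n :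
      U n ∈ Filter.comap f (𝓝 (f 0)))
    rw [map_zero] at hV₀
    have hcont : Filter.Tendsto (fun p : K × K => -p.1 + p.2) (𝓝 0 ×ˢ 𝓝 0) (𝓝 0) := by
      have h : Continuous fun p : K × K => -p.1 + p.2 := by fun_prop
      simpa [nhds_prod_eq] using h.tendsto (0, 0)
    obtain ⟨V, hV, hVV⟩ := Filter.mem_prod_self_iff.1 (hcont hV₀)
    obtain ⟨F, hF⟩ := compact_covered_by_add_left_translates (isCompact_univ (X := K))
      ⟨0, mem_interior_iff_mem_nhds.2 hV⟩
    have hF' : ∀ x : G, ∃ g ∈ F, g + f x ∈ V := fun x => by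
      simpa using hF (Set.mem_univ (f x))
    choose c hcF hc using hF'
    refine ⟨c, F.finite_toSet.subset (Set.range_subset_iff.2 hcF), fun x y hxy => hV₀U ?_⟩
    have h1 : -(c x + f x) + (c x + f y) ∈ V₀ :=
      hVV (Set.mk_mem_prod (hc x) (by rw [hxy]; exact hc y))
    rwa [neg_add_rev, add_assoc, neg_add_cancel_left, ← map_neg, ← map_add] at h1
  choose c hfin hc using hcov
  have henum : ∀ n, ∃ i : Set.range (c n) → ℕ, Function.Injective i := fun n => by
    have := (hfin n).to_subtype
    exact (nonempty_embedding_nat _).elim fun i => ⟨i, i.injective⟩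
  choose i hi using henum
  have hinj : Function.Injective fun (x : G) (n : ℕ) => i n ⟨c n x, x, rfl⟩ := by
    intro x y hxy
    have h1 : ∀ n, -x + y ∈ U n := fun n =>
      hc n x y (congrArg Subtype.val (hi n (congrFun hxy n)))
    by_contra hne
    have h2 : -x + y ≠ 0 := fun h => hne (neg_add_eq_zero.1 h)
    obtain ⟨n, -, hn⟩ := hU.1.mem_iff.1 (compl_singleton_mem_nhds h2.symm)
    exact hn (h1 n) rfl
  have hcard := Cardinal.mk_le_of_injective (Function.Injective.comp
    (ULift.up_injective) hinj : Function.Injective fun x : G => ULift.up _)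
  refine hcard.trans ?_
  rw [Cardinal.mk_uLift, ← Cardinal.power_def, Cardinal.mk_nat, Cardinal.aleph0_power_aleph0,
    Cardinal.lift_continuum]

/-- A single topology in which the closures of countably many sets are as large as possible. -/
theorem exists_isPrecompactMetric_closure_eq {G : Type*} [AddCommGroup G] (hG : #G ≤ 𝔠)
    {𝒳 : Set (Set G)} (h𝒳 : 𝒳.Countable) :
    ∃ t : TopologicalSpace G, IsPrecompactMetricGroupTopology t ∧
      ∀ X ∈ 𝒳, closure[t] X = closure[zariskiTopology G] X := by
  choose F hFfin hF hcov using fun X : Set G => exists_isSpread_cover_closure X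
  let S : Set (ℕ × (ℕ → G)) := ⋃ X ∈ 𝒳, F X
  have hS : S.Countable := h𝒳.biUnion fun X _ => (hFfin X).countable
  have hspread : ∀ p ∈ S, IsSpread p.1 p.2 := by
    intro p hp
    obtain ⟨X, _, hpX⟩ := Set.mem_iUnion₂.1 hp
    exact (hF X p hpX).2
  let H : AddSubgroup G := AddSubgroup.closure (⋃ p ∈ S, Set.range p.2)
  have hHc : (H : Set G).Countable :=
    countable_addSubgroup_closure (hS.biUnion fun p _ => Set.countable_range p.2)
  have hmem : ∀ p ∈ S, ∀ k, p.2 k ∈ H := fun p hp k =>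
    AddSubgroup.subset_closure (Set.mem_iUnion₂.2 ⟨p, hp, k, rfl⟩)
  obtain ⟨φ, hφ, hdense⟩ := exists_hom_closure_range (ι := ℕ × ℕ) hS hspread hHc
  obtain ⟨π, hπ, hπH⟩ := exists_injective_extension hG hHc (φ.comp H.subtype)
    ((injective_iff_map_eq_zero _).2 fun h h0 => by
      by_contra hne
      exact hφ h h.2 (fun h1 => hne (Subtype.ext h1)) h0)
  have ht := isPrecompactMetricGroupTopology_induced π hπ
  refine ⟨_, ht, fun X hX => Set.Subset.antisymm (closure_subset_closure_zariski
    ht.isPrecompact.isTopologicalAddGroup ht.isPrecompact.t2Space X) fun x hx => ?_⟩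
  obtain ⟨p, hp, hpx⟩ := hcov X x hx
  have hpS : p ∈ S := Set.mem_iUnion₂.2 ⟨X, hX, hp⟩
  rw [closure_induced]
  have h1 := hdense p hpS (π (x - p.2 0)) (by rw [← map_nsmul, hpx, map_zero])
  -- translate the dense sequence of differences by the image of the base point
  have h2 := map_mem_closure (t := π '' X) (continuous_add_const (π (p.2 0))) h1 (by
    rintro _ ⟨k, rfl⟩
    refine ⟨p.2 k, (hF X p hp).1 k, ?_⟩
    have h3 := hπH ⟨_, H.sub_mem (hmem p hpS k) (hmem p hpS 0)⟩
    change π (p.2 k - p.2 0) = φ (p.2 k - p.2 0) at h3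
    change π (p.2 k) = φ (p.2 k - p.2 0) + π (p.2 0)
    rw [← h3, ← map_add, sub_add_cancel])
  rwa [← map_add, sub_add_cancel] at h2

end MarkovZariski

theorem theoremC {G : Type*} [AddCommGroup G] :
    List.TFAE [
      #G ≤ 𝔠,
      ∀ X : Set G, ∃ t : TopologicalSpace G,
        MarkovZariski.IsPrecompactMetricGroupTopology t ∧
          closure[t] X = closure[MarkovZariski.zariskiTopology G] X,
      ∀ 𝒳 : Set (Set G), 𝒳.Countable → ∃ t : TopologicalSpace G,
        MarkovZariski.IsPrecompactMetricGroupTopology t ∧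
          ∀ X ∈ 𝒳, closure[t] X = closure[MarkovZariski.zariskiTopology G] X] := by
  tfae_have 1 → 3 := fun hG 𝒳 h𝒳 => MarkovZariski.exists_isPrecompactMetric_closure_eq hG h𝒳
  tfae_have 3 → 2 := fun h X => by
    obtain ⟨t, ht, htX⟩ := h {X} (Set.countable_singleton X)
    exact ⟨t, ht, htX X rfl⟩
  tfae_have 2 → 1 := fun h => by
    obtain ⟨t, ht, _⟩ := h ∅
    exact MarkovZariski.mk_le_continuum_of_isPrecompactMetric ht
  tfae_finish
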